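/- An $\omega$-Lie algebra over $\mathbb{C}$ is a complex vector space $\mathfrak g$ with a skew-symmetric bilinear bracket $[\cdot,\cdot]:\mathfrak g\times\mathfrak g\to\mathfrak g$ and a skew-symmetric bilinear form $\omega:\mathfrak g\times\mathfrak g\to\mathbb C$ such that $$[[x,y],z]+[[y,z],x]+[[z,x],y]=\omega(x,y)z+\omega(y,z)x+\omega(z,x)y\qquad(x,y,z\in\mathfrak g).$$ It is simple if its bracket is not identically zero and its only ideals (subspaces $I$ with $[I,\mathfrak g]\subseteq I$) are $0$ and $\mathfrak g$. A $\frac12$-derivation is a linear map $D:\mathfrak g\to\mathfrak g$ with $D([x,y])=\frac12([D(x),y]+[x,D(y)])$ for all $x,y$. A 2-local $\frac12$-derivation is a (not necessarily linear) map $f:\mathfrak g\to\mathfrak g$ such that for all $x,y\in\mathfrak g$ there is a $\frac12$-derivation $D_{x,y}$ with $f(x)=D_{x,y}(x)$ and $f(y)=D_{x,y}(y)$. For $\alpha\in\mathbb C$, let $C_\alpha$ be the $\omega$-Lie algebra with basis $e_1,e_2,e_3$, $[e_1,e_2]=e_2$, $[e_1,e_3]=\alpha e_3$, $[e_2,e_3]=e_1$,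 $\omega(e_1,e_2)=\omega(e_1,e_3)=0$, $\omega(e_2,e_3)=1+\alpha$. **Theorem.** Let $\mathfrak g$ be a finite-dimensional simple $\omega$-Lie algebra over $\mathbb C$. Then every 2-local $\frac12$-derivation $f$ of $\mathfrak g$ is a $\frac12$-derivation (in particular, $f$ is linear). Moreover, if $\mathfrak g$ is isomorphic neither to $C_2$ nor to $C_{-4}$, then there is $\lambda\in\mathbb C$ with $f(x)=\lambda x$ for all $x\in\mathfrak g$. -/

import Mathlib

/-- An `ω`-Lie algebra structure on a complex vector space `V`: a skew-symmetric bilinear bracket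
and a skew-symmetric bilinear form `ω` such that
`[[x,y],z] + [[y,z],x] + [[z,x],y] = ω(x,y) z + ω(y,z) x + ω(z,x) y`. -/
structure OmegaLieAlgebra (V : Type*) [AddCommGroup V] [Module ℂ V] where
  /-- the bracket -/
  bracket : V →ₗ[ℂ] V →ₗ[ℂ] V
  /-- the bilinear form -/
  ω : V →ₗ[ℂ] V →ₗ[ℂ] ℂ
  bracket_skew : ∀ x y, bracket x y = -bracket y x
  ω_skew : ∀ x y, ω x y = -ω y x
  jacobi : ∀ x y z,
    bracket (bracket x y) z + bracket (bracket y z) x + bracket (bracket z x) y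
      = ω x y • z + ω y z • x + ω z x • y

namespace OmegaLieAlgebra

variable {V : Type*} [AddCommGroup V] [Module ℂ V]

/-- A subspace `I` is an ideal if `[x, y] ∈ I` for all `x ∈ I` and all `y`
(by skew-symmetry, left and right ideals coincide). -/
def IsIdeal (L : OmegaLieAlgebra V) (I : Submodule ℂ V) : Prop :=
  ∀ x ∈ I, ∀ y, L.bracket x y ∈ I

/-- Simplicity: the bracket is not identically zero and the only ideals are `0` and `V`. -/
def IsSimple (L : OmegaLieAlgebra V) : Prop :=
  (∃ x y, L.bracket x y ≠ 0) ∧ ∀ I : Submodule ℂ V, L.IsIdeal I → I = ⊥ ∨ I = ⊤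

/-- A linear map `D` is a `½`-derivation if `D [x,y] = ½ ([D x, y] + [x, D y])`. -/
def IsHalfDerivation (L : OmegaLieAlgebra V) (D : V →ₗ[ℂ] V) : Prop :=
  ∀ x y, D (L.bracket x y) = (1 / 2 : ℂ) • (L.bracket (D x) y + L.bracket x (D y))

/-- A map `f`, not assumed to be linear, is a 2-local `½`-derivation if for any two points some
`½`-derivation agrees with `f` at both of them. -/
def IsTwoLocalHalfDerivation (L : OmegaLieAlgebra V) (f : V → V) : Prop :=
  ∀ x y, ∃ D : V →ₗ[ℂ] V, L.IsHalfDerivation D ∧ f x = D x ∧ f y = D y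

/-- `L` is isomorphic to the three-dimensional algebra `C_α`: it has a basis `e₁, e₂, e₃`
(here indexed by `0, 1, 2`) with `[e₁,e₂] = e₂`, `[e₁,e₃] = α e₃`, `[e₂,e₃] = e₁`,
`ω(e₁,e₂) = ω(e₁,e₃) = 0` and `ω(e₂,e₃) = 1 + α`. -/
def IsTypeC (L : OmegaLieAlgebra V) (α : ℂ) : Prop :=
  ∃ e : Module.Basis (Fin 3) ℂ V,
    L.bracket (e 0) (e 1) = e 1 ∧ L.bracket (e 0) (e 2) = α • e 2 ∧
    L.bracket (e 1) (e 2) = e 0 ∧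
    L.ω (e 0) (e 1) = 0 ∧ L.ω (e 0) (e 2) = 0 ∧ L.ω (e 1) (e 2) = 1 + α

end OmegaLieAlgebra

namespace OmegaLieAlgebra

open Module

variable {V : Type*} [AddCommGroup V] [Module ℂ V]

/-! Call v separating if a ½-derivation vanishing at v is zero. Given such a v, 2-locality
collapses: f agrees with some D at v, and any E agreeing with f at v and x has E v = D v, hence E =
D and f x = D x. If all ½-derivations are scalar, any nonzero vector separates; on C₂ and C₋₄ a
basis vector does (`IsTypeC.exists_separating`).

Scalarity is proved by dimension, which is at least 3. From dimension 4 on, ω = 0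
(`IsSimple.ω_eq_zero`): ω has rank at most two, and the action of its radical on the quotient plane
contradicts simplicity unless ω vanishes. The Killing form then puts D in the centroid. In dimension
3, D has a single eigenvalue a, because brackets send pairs of eigenvalues to their midpoints; if D
- a is nonzero, its Jordan type, (3) or (2,1), forces C₋₄ or C₂. -/

/-! ### Elementary facts -/

lemma bracket_self (L : OmegaLieAlgebra V) (x : V) : L.bracket x x = 0 := by
  have h : (2 : ℂ) • L.bracket x x = 0 := by
    linear_combination (norm := module) L.bracket_skew x x
  simpa using h

lemma ω_self (L : OmegaLieAlgebra V) (x : V) : L.ω x x = 0 := by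
  have h := L.ω_skew x x
  rwa [self_eq_neg] at h

/-- The span of all brackets is the whole of a simple algebra, in dual form. -/
lemma IsSimple.eq_zero_of_apply_bracket {L : OmegaLieAlgebra V} (hL : L.IsSimple)
    (φ : V →ₗ[ℂ] ℂ) (hφ : ∀ x y, φ (L.bracket x y) = 0) : φ = 0 := by
  have hI : L.IsIdeal (LinearMap.ker φ) := fun x _ y => hφ x y
  rcases hL.2 _ hI with h | h
  · obtain ⟨x, y, hxy⟩ := hL.1
    exact absurd (by simpa [h] using (LinearMap.mem_ker.2 (hφ x y))) hxy
  · exact LinearMap.ker_eq_top.1 h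

lemma IsHalfDerivation.sub_smul_one {L : OmegaLieAlgebra V} {D : V →ₗ[ℂ] V}
    (hD : L.IsHalfDerivation D) (a : ℂ) : L.IsHalfDerivation (D - a • 1) := by
  intro x y
  simp only [LinearMap.sub_apply, LinearMap.smul_apply, Module.End.one_apply, hD x y, map_sub,
    map_smul]
  module

lemma IsHalfDerivation.sub {L : OmegaLieAlgebra V} {D E : V →ₗ[ℂ] V}
    (hD : L.IsHalfDerivation D) (hE : L.IsHalfDerivation E) : L.IsHalfDerivation (D - E) := by
  intro x y
  simp only [LinearMap.sub_apply, hD x y, hE x y, map_sub]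
  module

/-! ### Eigenvalues of half-derivations -/

/-- Generalized eigenvectors of a half-derivation multiply to generalized eigenvectors for the
midpoint of the eigenvalues. -/
lemma IsHalfDerivation.pow_bracket_eq_zero {L : OmegaLieAlgebra V} {D : V →ₗ[ℂ] V}
    (hD : L.IsHalfDerivation D) {b c m : ℂ} (hm : b + c = 2 * m) :
    ∀ (n i j : ℕ) (x y : V), i + j = n → ((D - b • 1) ^ i) x = 0 → ((D - c • 1) ^ j) y = 0 →
      ((D - m • 1) ^ n) (L.bracket x y) = 0 := by
  intro n
  induction n with
  | zero =>
    intro i j x y hij hx hy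
    obtain ⟨rfl, rfl⟩ : i = 0 ∧ j = 0 := by omega
    simp at hx
    simp [hx]
  | succ n ih =>
    intro i j x y hij hx hy
    rcases i with _ | i
    · simp at hx
      simp [hx]
    rcases j with _ | j
    · simp at hy
      simp [hy]
    have key : (D - m • 1) (L.bracket x y) =
        (1 / 2 : ℂ) • (L.bracket ((D - b • 1) x) y + L.bracket x ((D - c • 1) y)) := by
      obtain rfl : m = (b + c) / 2 := by rw [hm]; ring
      simp only [LinearMap.sub_apply, LinearMap.smul_apply, Module.End.one_apply, hD x y, map_sub,
        map_smul]
      module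
    rw [pow_succ, Module.End.mul_apply, key, map_smul, map_add,
      ih i (j + 1) _ _ (by omega) (by rw [pow_succ, Module.End.mul_apply] at hx; exact hx) hy,
      ih (i + 1) j _ _ (by omega) hx (by rw [pow_succ, Module.End.mul_apply] at hy; exact hy)]
    simp

lemma IsHalfDerivation.bracket_mem_maxGenEigenspace {L : OmegaLieAlgebra V} {D : V →ₗ[ℂ] V}
    (hD : L.IsHalfDerivation D) {b c : ℂ} {x y : V} (hx : x ∈ End.maxGenEigenspace D b)
    (hy : y ∈ End.maxGenEigenspace D c) :
    L.bracket x y ∈ End.maxGenEigenspace D ((b + c) / 2) := by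
  rw [End.mem_maxGenEigenspace] at hx hy ⊢
  obtain ⟨i, hi⟩ := hx
  obtain ⟨j, hj⟩ := hy
  exact ⟨i + j, hD.pow_bracket_eq_zero (by ring) _ i j x y rfl hi hj⟩

/-- Strict convexity of the disc, from the parallelogram law for b - a and a. -/
lemma _root_.Complex.eq_of_norm_le_of_add_eq {a b c : ℂ} (hb : ‖b‖ ≤ ‖a‖) (hc : ‖c‖ ≤ ‖a‖)
    (h : (b + c) / 2 = a) : b = a := by
  obtain rfl : c = 2 * a - b := by rw [← h]; ring
  have h1 := parallelogram_law_with_norm ℝ (b - a) a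
  have e1 : b - a + a = b := by ring
  have e2 : ‖b - a - a‖ = ‖2 * a - b‖ := by rw [← norm_neg]; congr 1; ring
  rw [e1, e2] at h1
  have h2 : ‖b - a‖ = 0 := by
    nlinarith [norm_nonneg b, norm_nonneg (2 * a - b), norm_nonneg (b - a), norm_nonneg a]
  exact sub_eq_zero.1 (norm_eq_zero.1 h2)

lemma hasEigenvalue_of_mem_maxGenEigenspace {D : V →ₗ[ℂ] V} {b : ℂ} {x : V}
    (hx : x ∈ End.maxGenEigenspace D b) (h0 : x ≠ 0) : End.HasEigenvalue D b := by
  refine End.HasUnifEigenvalue.lt (k := ⊤) (m := 1) zero_lt_one ?_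
  intro h
  exact h0 (by simpa [h] using (show x ∈ End.genEigenspace D b ⊤ from hx))

/-- A half-derivation of a simple algebra has a single eigenvalue. -/
lemma IsHalfDerivation.exists_isNilpotent [FiniteDimensional ℂ V] {L : OmegaLieAlgebra V}
    (hL : L.IsSimple) {D : V →ₗ[ℂ] V} (hD : L.IsHalfDerivation D) :
    ∃ a : ℂ, IsNilpotent (D - a • (1 : End ℂ V)) := by
  have : Nontrivial V := by
    obtain ⟨x, y, h⟩ := hL.1
    exact ⟨_, _, h⟩
  obtain ⟨a0, ha0⟩ := End.exists_eigenvalue D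
  obtain ⟨a, ha, hmax⟩ := Set.exists_max_image {b : ℂ | End.HasEigenvalue D b} (fun b => ‖b‖)
    (End.finite_hasEigenvalue D) ⟨a0, ha0⟩
  refine ⟨a, ?_⟩
  -- Since a has maximal modulus, a midpoint (b + c)/2 of eigenvalues equals a only if b = c = a.
  -- Hence W is an ideal, and it is proper because the a-space is nonzero.
  set W : Submodule ℂ V := ⨆ b, ⨆ (_ : b ≠ a), End.maxGenEigenspace D b with hW
  have hle : ∀ b, b ≠ a → End.maxGenEigenspace D b ≤ W := fun b hb =>
    le_iSup₂_of_le b hb le_rfl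
  have htop := End.iSup_maxGenEigenspace_eq_top D
  have hdisj : Disjoint (End.maxGenEigenspace D a) W := End.independent_maxGenEigenspace D a
  have hbr : ∀ b, b ≠ a → ∀ x ∈ End.maxGenEigenspace D b, ∀ c, ∀ y ∈ End.maxGenEigenspace D c,
      L.bracket x y ∈ W := by
    intro b hb x hx c y hy
    by_cases hx0 : x = 0
    · simp [hx0]
    by_cases hy0 : y = 0
    · simp [hy0]
    refine hle _ ?_ (hD.bracket_mem_maxGenEigenspace hx hy)
    intro h
    exact hb (Complex.eq_of_norm_le_of_add_eq
      (hmax _ (hasEigenvalue_of_mem_maxGenEigenspace hx hx0))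
      (hmax _ (hasEigenvalue_of_mem_maxGenEigenspace hy hy0)) h)
  have hI : L.IsIdeal W := by
    intro x hx y
    have hy : y ∈ ⨆ c, End.maxGenEigenspace D c := by rw [htop]; trivial
    have h1 : W ≤ W.comap (L.bracket.flip y) := by
      refine iSup₂_le fun b hb x hx => ?_
      have h2 : (⨆ c, End.maxGenEigenspace D c) ≤ W.comap (L.bracket x) :=
        iSup_le fun c y hy => hbr b hb x hx c y hy
      exact h2 hy
    exact h1 hx
  obtain ⟨v, hv, hv0⟩ := Submodule.exists_mem_ne_zero_of_ne_bot ha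
  have hv' : v ∈ End.maxGenEigenspace D a := End.eigenspace_le_maxGenEigenspace hv
  rcases hL.2 W hI with h | h
  · have hall : End.maxGenEigenspace D a = ⊤ := by
      rw [eq_top_iff, ← htop]
      refine iSup_le fun b => ?_
      by_cases hb : b = a
      · rw [hb]
      · exact (hle b hb).trans (by rw [h]; exact bot_le)
    refine ⟨finrank ℂ V, LinearMap.ext fun x => ?_⟩
    have hx : x ∈ End.maxGenEigenspace D a := by rw [hall]; trivial
    rw [End.maxGenEigenspace_eq_genEigenspace_finrank, End.mem_genEigenspace_nat] at hx
    simpa using hx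
  · exact absurd (Submodule.disjoint_def.1 hdisj v hv' (by rw [h]; trivial)) hv0

/-! ### The Lie case: Killing form and centroid -/

/-- The Lie ring underlying an `ω`-Lie algebra with `ω = 0`. -/
abbrev toLieRing (L : OmegaLieAlgebra V) (hω : ∀ x y, L.ω x y = 0) : LieRing V where
  bracket x y := L.bracket x y
  add_lie x y z := by simp
  lie_add x y z := by simp
  lie_self x := L.bracket_self x
  leibniz_lie x y z := by
    have h := L.jacobi x y z
    simp only [hω, zero_smul, add_zero] at h
    have h1 := L.bracket_skew (L.bracket y z) x
    have h2 := L.bracket_skew (L.bracket z x) y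
    have h3 : L.bracket y (L.bracket z x) = - L.bracket y (L.bracket x z) := by
      rw [L.bracket_skew z x, map_neg]
    rw [h1, h2, h3] at h
    change L.bracket x (L.bracket y z) = L.bracket (L.bracket x y) z + L.bracket y (L.bracket x z)
    linear_combination (norm := module) -h

lemma eq_zero_of_trace_eq_zero [FiniteDimensional ℂ V] {L : OmegaLieAlgebra V} (hL : L.IsSimple)
    (hω : ∀ x y, L.ω x y = 0) (x : V)
    (hx : ∀ y, LinearMap.trace ℂ V (L.bracket x ∘ₗ L.bracket y) = 0) : x = 0 := by
  let : LieRing V := L.toLieRing hω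
  let : LieAlgebra ℂ V := { lie_smul := fun t x y => (L.bracket x).map_smul t y }
  have : LieAlgebra.IsSimple ℂ V := by
    refine ⟨fun I => ?_, fun h => ?_⟩
    · have hI : L.IsIdeal I.toSubmodule := by
        intro x hx y
        rw [L.bracket_skew]
        exact neg_mem (I.lie_mem (x := y) hx)
      rcases hL.2 _ hI with h | h
      · exact Or.inl ((LieSubmodule.toSubmodule_eq_bot I).1 h)
      · exact Or.inr ((LieSubmodule.toSubmodule_eq_top I).1 h)
    · obtain ⟨x, y, hxy⟩ := hL.1
      exact hxy (h.trivial x y)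
  have hk := LieAlgebra.IsKilling.ker_killingForm_eq_bot ℂ V
  have : x ∈ LinearMap.ker (killingForm ℂ V) := by
    rw [LinearMap.mem_ker]
    ext y
    exact hx y
  rw [hk] at this
  simpa using this

/-- Half-derivations of a finite-dimensional simple Lie algebra are scalar. -/
lemma IsHalfDerivation.exists_eq_smul_of_ω_eq_zero [FiniteDimensional ℂ V]
    {L : OmegaLieAlgebra V} (hL : L.IsSimple) (hω : ∀ x y, L.ω x y = 0) {D : V →ₗ[ℂ] V}
    (hD : L.IsHalfDerivation D) : ∃ c : ℂ, ∀ x, D x = c • x := by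
  have had : ∀ x, L.bracket (D x) = (2 : ℂ) • (D ∘ₗ L.bracket x) - L.bracket x ∘ₗ D := by
    intro x
    ext y
    simp only [LinearMap.sub_apply, LinearMap.smul_apply, LinearMap.comp_apply, hD x y]
    module
  have hadd : ∀ x y, L.bracket (L.bracket x y) =
      L.bracket x ∘ₗ L.bracket y - L.bracket y ∘ₗ L.bracket x := by
    intro x y
    ext z
    let : LieRing V := L.toLieRing hω
    exact lie_lie x y z
  set tr := LinearMap.trace ℂ V
  have trc : ∀ f g : V →ₗ[ℂ] V, tr (f ∘ₗ g) = tr (g ∘ₗ f) := fun f g => LinearMap.trace_comp_comm' g f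
  have htr0 : tr ∘ₗ L.bracket = 0 := by
    refine hL.eq_zero_of_apply_bracket _ fun x y => ?_
    simp only [LinearMap.comp_apply, hadd, map_sub]
    rw [trc, sub_self]
  -- The trace of `had` reads tr(ad(D x)) = tr(D ∘ ad x), and the left side is zero.
  have htrD : ∀ x, tr (D ∘ₗ L.bracket x) = 0 := by
    intro x
    have h1 := LinearMap.congr_fun htr0 (D x)
    simp only [LinearMap.comp_apply, had x, map_sub, map_smul, LinearMap.zero_apply] at h1
    rw [trc (L.bracket x) D, smul_eq_mul] at h1
    linear_combination h1
  set κ : V → V → ℂ := fun x y => tr (L.bracket x ∘ₗ L.bracket y) with hκ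
  -- The difference of the two sides is 3 tr(D ∘ ad [x,y]).
  have κD : ∀ x y, κ (D x) y = κ x (D y) := by
    intro x y
    have h1 := htrD (L.bracket x y)
    simp only [hκ, had, LinearMap.sub_comp, LinearMap.smul_comp, LinearMap.comp_sub,
      LinearMap.comp_smul, map_sub, map_smul, hadd, smul_eq_mul] at h1 ⊢
    have e1 : tr ((D ∘ₗ L.bracket x) ∘ₗ L.bracket y) = tr (D ∘ₗ L.bracket x ∘ₗ L.bracket y) := rfl
    have e2 : tr ((L.bracket x ∘ₗ D) ∘ₗ L.bracket y) = tr (D ∘ₗ L.bracket y ∘ₗ L.bracket x) := by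
      rw [LinearMap.comp_assoc, trc]; rfl
    have e3 : tr (L.bracket x ∘ₗ D ∘ₗ L.bracket y) = tr (D ∘ₗ L.bracket y ∘ₗ L.bracket x) := by
      rw [trc]; rfl
    have e4 : tr (L.bracket x ∘ₗ L.bracket y ∘ₗ D) = tr (D ∘ₗ L.bracket x ∘ₗ L.bracket y) := by
      rw [← LinearMap.comp_assoc, trc]
    rw [e1, e2, e3, e4]
    linear_combination 3 * h1
  have κinv : ∀ x y z, κ (L.bracket x y) z = κ x (L.bracket y z) := by
    intro x y z
    simp only [hκ, hadd, LinearMap.sub_comp, LinearMap.comp_sub, map_sub]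
    rw [LinearMap.comp_assoc, LinearMap.comp_assoc, trc (L.bracket y)]
    rfl
  have κadd : ∀ x y z, κ x (y + z) = κ x y + κ x z := by
    intro x y z; simp only [hκ, map_add, LinearMap.comp_add]
  have κsymm : ∀ x y, κ x y = κ y x := fun x y => trc _ _
  have κsub : ∀ x y z, κ x (y - z) = κ x y - κ x z := by
    intro x y z; simp only [hκ, map_sub, LinearMap.comp_sub]
  have κsmul : ∀ (t : ℂ) x y, κ x (t • y) = t * κ x y := by
    intro t x y; simp only [hκ, map_smul, LinearMap.comp_smul, smul_eq_mul]
  -- Moving everything off x in κ(D[x,y], z) in two ways pairs x with [y,Dz] and with ¾[Dy,z] +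
  -- ¼[y,Dz].
  have hcent : ∀ y z, L.bracket (D y) z = L.bracket y (D z) := by
    intro y z
    rw [← sub_eq_zero]
    refine eq_zero_of_trace_eq_zero hL hω _ fun x => ?_
    change κ _ x = 0
    rw [κsymm, κsub]
    have h1 : κ (D (L.bracket x y)) z = κ x (L.bracket y (D z)) := by rw [κD, κinv]
    have h2 : κ (D (L.bracket x y)) z = (1 / 2) * (κ (D x) (L.bracket y z)
        + κ x (L.bracket (D y) z)) := by
      rw [hD x y, κsymm, κsmul, κadd, κsymm _ (L.bracket (D x) y), κsymm _ (L.bracket x (D y)),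
        κinv, κinv]
    rw [κD x, hD y z, κsmul, κadd] at h2
    linear_combination (4 / 3) * (h1.symm.trans h2).symm
  have : Nontrivial V := by
    obtain ⟨x, y, h⟩ := hL.1
    exact ⟨_, _, h⟩
  obtain ⟨c, hc⟩ := End.exists_eigenvalue D
  have hI : L.IsIdeal (End.eigenspace D c) := by
    intro x hx y
    rw [End.mem_eigenspace_iff] at hx ⊢
    rw [hD, ← hcent, hx, map_smul, LinearMap.smul_apply]
    module
  rcases hL.2 _ hI with h | h
  · exact absurd h hc
  · exact ⟨c, fun x => End.mem_eigenspace_iff.1 (by rw [h]; trivial)⟩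

/-! ### The form ω: coboundary, rank and radical -/

lemma bracket_bracket (L : OmegaLieAlgebra V) (x y z : V) :
    L.bracket (L.bracket x y) z = L.bracket x (L.bracket y z) - L.bracket y (L.bracket x z)
      + (L.ω x y • z + L.ω y z • x - L.ω x z • y) := by
  have h := L.jacobi x y z
  have h1 := L.bracket_skew (L.bracket y z) x
  have h2 : L.bracket (L.bracket z x) y = L.bracket y (L.bracket x z) := by
    rw [L.bracket_skew (L.bracket z x) y, L.bracket_skew z x, map_neg, neg_neg]
  rw [h1, h2, L.ω_skew z x] at h
  linear_combination (norm := module) h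

/-- The form `ω` is a coboundary as soon as the dimension is not two. -/
lemma exists_ω_eq_apply_bracket [FiniteDimensional ℂ V] (L : OmegaLieAlgebra V)
    (hn : finrank ℂ V ≠ 2) : ∃ l : V →ₗ[ℂ] ℂ, ∀ x y, L.ω x y = l (L.bracket x y) := by
  have hn' : (finrank ℂ V : ℂ) - 2 ≠ 0 := by
    rw [sub_ne_zero]
    exact_mod_cast hn
  -- In tr ad [x,y] the commutator drops out, the identity contributes n ω(x,y) and the two rank-one
  -- terms -2 ω(x,y).
  refine ⟨((finrank ℂ V : ℂ) - 2)⁻¹ • (LinearMap.trace ℂ V ∘ₗ L.bracket), fun x y => ?_⟩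
  have h : L.bracket (L.bracket x y) = L.bracket x ∘ₗ L.bracket y - L.bracket y ∘ₗ L.bracket x
      + (L.ω x y • LinearMap.id + (L.ω y).smulRight x - (L.ω x).smulRight y) := by
    ext z
    simpa using L.bracket_bracket x y z
  simp only [LinearMap.smul_apply, LinearMap.comp_apply, h, map_add, map_sub, map_smul,
    LinearMap.trace_id, LinearMap.trace_smulRight, smul_eq_mul]
  rw [LinearMap.trace_comp_comm' (L.bracket x) (L.bracket y), L.ω_skew y x]
  field_simp
  ring

/-- The four-variable identity obtained from the closedness of the Jacobi identity. -/
lemma four_variable_identity (L : OmegaLieAlgebra V) {l : V →ₗ[ℂ] ℂ}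
    (hl : ∀ x y, L.ω x y = l (L.bracket x y)) (x y z t : V) :
    L.ω x y • L.bracket z t - L.ω x z • L.bracket y t + L.ω x t • L.bracket y z
      + L.ω y z • L.bracket x t - L.ω y t • L.bracket x z + L.ω z t • L.bracket x y
    = (L.ω x y * l z - L.ω x z * l y + L.ω y z * l x) • t
      - (L.ω x y * l t - L.ω x t * l y + L.ω y t * l x) • z
      + (L.ω x z * l t - L.ω x t * l z + L.ω z t * l x) • y
      - (L.ω y z * l t - L.ω y t * l z + L.ω z t * l y) • x := by
  have N : ∀ a b c, L.bracket (L.bracket a b) c - L.bracket (L.bracket a c) b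
      + L.bracket (L.bracket b c) a = L.ω a b • c - L.ω a c • b + L.ω b c • a := by
    intro a b c
    rw [L.bracket_bracket, L.bracket_skew (L.bracket a c) b, L.bracket_skew (L.bracket b c) a]
    module
  have W : ∀ a b c, L.ω (L.bracket a b) c - L.ω (L.bracket a c) b + L.ω (L.bracket b c) a
      = L.ω a b * l c - L.ω a c * l b + L.ω b c * l a := by
    intro a b c
    have h := congrArg l (N a b c)
    simpa only [map_add, map_sub, map_smul, ← hl, smul_eq_mul] using h
  have M : ∀ a b c d, L.bracket (L.bracket (L.bracket a b) c) d
      - L.bracket (L.bracket (L.bracket a c) b) d + L.bracket (L.bracket (L.bracket b c) a) d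
      = L.ω a b • L.bracket c d - L.ω a c • L.bracket b d + L.ω b c • L.bracket a d := by
    intro a b c d
    have h := congrArg (fun v => L.bracket v d) (N a b c)
    simpa only [map_add, map_sub, map_smul, LinearMap.add_apply, LinearMap.sub_apply,
      LinearMap.smul_apply] using h
  have m1 := M x y z t
  have m2 := M x y t z
  have m3 := M x z t y
  have m4 := M y z t x
  rw [L.bracket_skew t z] at m2
  rw [L.bracket_skew t y, L.bracket_skew z y] at m3
  rw [L.bracket_skew t x, L.bracket_skew z x, L.bracket_skew y x] at m4
  -- Alternating sum of the Jacobi identity over the six pairs, each bracketed and taken with the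
  -- other two vectors: products of two brackets cancel, triple brackets regroup by `M`, the
  -- ω-coefficients by `W`.
  linear_combination (norm := module) m4 - m3 + m2 - m1
    + N (L.bracket x y) z t - N (L.bracket x z) y t + N (L.bracket x t) y z
    + N (L.bracket y z) x t - N (L.bracket y t) x z + N (L.bracket z t) x y
    - L.bracket_skew (L.bracket x y) (L.bracket z t)
    + L.bracket_skew (L.bracket x z) (L.bracket y t)
    - L.bracket_skew (L.bracket x t) (L.bracket y z)
    + (W x y z) • t - (W x y t) • z + (W x z t) • y - (W y z t) • x

/-- The form `ω` has rank at most two. -/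
lemma pfaffian_ω (L : OmegaLieAlgebra V) {l : V →ₗ[ℂ] ℂ}
    (hl : ∀ x y, L.ω x y = l (L.bracket x y)) (x y z t : V) :
    L.ω x y * L.ω z t - L.ω x z * L.ω y t + L.ω x t * L.ω y z = 0 := by
  -- Under l the left side becomes twice the Pfaffian and the right side ω ∧ l ∧ l = 0.
  have h := congrArg l (L.four_variable_identity hl x y z t)
  simp only [map_add, map_sub, map_smul, ← hl, smul_eq_mul] at h
  linear_combination h / 2

lemma exists_ne_zero_of_four_le_finrank [FiniteDimensional ℂ V] (hn : 4 ≤ finrank ℂ V)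
    (f g h : V →ₗ[ℂ] ℂ) : ∃ x, x ≠ 0 ∧ f x = 0 ∧ g x = 0 ∧ h x = 0 := by
  have hker : LinearMap.ker (f.prod (g.prod h)) ≠ ⊥ := by
    apply LinearMap.ker_ne_bot_of_finrank_lt
    simp only [finrank_prod, finrank_self]
    omega
  obtain ⟨x, hx, hx0⟩ := Submodule.exists_mem_ne_zero_of_ne_bot hker
  have hx' : (f x, g x, h x) = 0 := hx
  exact ⟨x, hx0, by simpa using hx'⟩

/-- A vector spanning an ideal of a simple algebra of dimension at least two vanishes. -/
lemma IsSimple.eq_zero_of_forall_bracket_eq_smul {L : OmegaLieAlgebra V} (hL : L.IsSimple) {k : V}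
    (hk : ∀ y, ∃ c : ℂ, L.bracket k y = c • k) : k = 0 := by
  have hI : L.IsIdeal (ℂ ∙ k) := by
    intro x hx y
    obtain ⟨a, rfl⟩ := Submodule.mem_span_singleton.1 hx
    obtain ⟨c, hc⟩ := hk y
    rw [map_smul, LinearMap.smul_apply, hc]
    exact Submodule.smul_mem _ _ (Submodule.smul_mem _ _ (Submodule.mem_span_singleton_self k))
  rcases hL.2 _ hI with h | h
  · simpa using h
  · obtain ⟨x, y, hxy⟩ := hL.1
    obtain ⟨a, rfl⟩ := Submodule.mem_span_singleton.1 (show x ∈ (ℂ ∙ k) by rw [h]; trivial)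
    obtain ⟨b, rfl⟩ := Submodule.mem_span_singleton.1 (show y ∈ (ℂ ∙ k) by rw [h]; trivial)
    simp [L.bracket_self] at hxy

section Decomposition

variable (L : OmegaLieAlgebra V) {l : V →ₗ[ℂ] ℂ} {y₁ y₂ : V}

/-- If `ω` has rank two and `ω(y₁,y₂) = w ≠ 0`, then `V` is spanned by `y₁`, `y₂` and the radical
of `ω`. -/
lemma exists_eq_add_radical (hl : ∀ x y, L.ω x y = l (L.bracket x y))
    (hw : L.ω y₁ y₂ ≠ 0) (v : V) :
    ∃ (a b : ℂ) (k : V), v = a • y₁ + b • y₂ + k ∧ L.ω k = 0 := by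
  refine ⟨(L.ω y₁ y₂)⁻¹ * L.ω v y₂, -((L.ω y₁ y₂)⁻¹ * L.ω v y₁), _, (add_sub_cancel _ v).symm, ?_⟩
  ext t
  have h := L.pfaffian_ω hl v t y₁ y₂
  simp only [map_sub, map_add, map_smul, LinearMap.sub_apply, LinearMap.add_apply,
    LinearMap.smul_apply, smul_eq_mul, LinearMap.zero_apply, map_neg, neg_smul, LinearMap.neg_apply]
  rw [L.ω_skew t y₁, L.ω_skew t y₂] at h
  field_simp
  linear_combination h

lemma ω_eq_zero_of_apply_eq_zero (hl : ∀ x y, L.ω x y = l (L.bracket x y))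
    (hw : L.ω y₁ y₂ ≠ 0) {v : V} (h1 : L.ω v y₁ = 0) (h2 : L.ω v y₂ = 0) : L.ω v = 0 := by
  ext t
  have h := L.pfaffian_ω hl v t y₁ y₂
  simpa [h1, h2, hw] using h

/-- With y₁, y₂ as last arguments of `four_variable_identity`, only the terms in ω(y₁,y₂) survive.
So the radical is abelian if l vanishes on it; otherwise an h with l h = 1 acts as the identity on
its abelian part in ker l. -/
lemma bracket_radical (hl : ∀ x y, L.ω x y = l (L.bracket x y))
    (hw : L.ω y₁ y₂ ≠ 0) {x y : V} (hx : L.ω x = 0) (hy : L.ω y = 0) :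
    L.bracket x y = l x • y - l y • x := by
  have h := L.four_variable_identity hl x y y₁ y₂
  simp only [hx, hy, LinearMap.zero_apply, zero_smul, sub_zero, zero_add, add_zero,
    zero_mul] at h
  refine smul_right_injective V hw ?_
  simp only [h]
  module

/-- When ω ≠ 0, this says that ad x acts on the plane V / rad ω with trace l x. -/
lemma ω_bracket_radical (hl : ∀ x y, L.ω x y = l (L.bracket x y)) {x : V} (hx : L.ω x = 0)
    (y z : V) : L.ω (L.bracket x y) z = l x * L.ω y z - L.ω y (L.bracket x z) := by
  have h := congrArg l (L.bracket_bracket x y z)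
  simp only [map_sub, map_add, map_smul, ← hl, hx, LinearMap.zero_apply, smul_eq_mul] at h
  linear_combination h

lemma bracket_comm_radical {x y : V} (hx : L.ω x = 0) (hy : L.ω y = 0) (z : V) :
    L.bracket x (L.bracket y z) = L.bracket (L.bracket x y) z + L.bracket y (L.bracket x z) := by
  rw [L.bracket_bracket]
  simp [hx, hy]

lemma ω_right_radical {x : V} (hx : L.ω x = 0) (y : V) : L.ω y x = 0 := by
  rw [L.ω_skew, hx]; simp

end Decomposition

/-! ### Vanishing of ω in dimension at least four -/

/-- In dimension at least four, the cochain bounding `ω` vanishes on the radical of `ω`. -/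
lemma IsSimple.apply_radical_ne_one [FiniteDimensional ℂ V] {L : OmegaLieAlgebra V}
    (hL : L.IsSimple) (hn : 4 ≤ finrank ℂ V) {l : V →ₗ[ℂ] ℂ}
    (hl : ∀ x y, L.ω x y = l (L.bracket x y)) {y₁ y₂ : V} (hw : L.ω y₁ y₂ ≠ 0)
    {h : V} (hh : L.ω h = 0) : l h ≠ 1 := by
  intro hlh
  have hrad : ∀ x y, L.ω x = 0 → l x = 0 → L.ω y = 0 → L.ω (L.bracket x y) = 0 := by
    intro x y hx hlx hy
    rw [L.bracket_radical hl hw hx hy, hlx]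
    simp [hx]
  -- Otherwise ker ω ∩ ker l is a proper ideal, nonzero since its codimension is at most three.
  obtain ⟨x, hx, hlx, v, hxv⟩ : ∃ x, L.ω x = 0 ∧ l x = 0 ∧ ∃ v, L.ω (L.bracket x v) ≠ 0 := by
    by_contra! hcon
    have hI : L.IsIdeal (LinearMap.ker L.ω ⊓ LinearMap.ker l) := by
      intro x hx v
      obtain ⟨hx1, hx2⟩ := Submodule.mem_inf.1 hx
      rw [LinearMap.mem_ker] at hx1 hx2
      refine Submodule.mem_inf.2 ⟨hcon x hx1 hx2 v, ?_⟩
      rw [LinearMap.mem_ker, ← hl, hx1, LinearMap.zero_apply]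
    rcases hL.2 _ hI with hb | ht
    · obtain ⟨x, hx0, h1, h2, h3⟩ :=
        exists_ne_zero_of_four_le_finrank hn (L.ω.flip y₁) (L.ω.flip y₂) l
      have hx : x ∈ LinearMap.ker L.ω ⊓ LinearMap.ker l :=
        ⟨L.ω_eq_zero_of_apply_eq_zero hl hw h1 h2, h3⟩
      rw [hb] at hx
      exact hx0 (by simpa using hx)
    · have hy : y₁ ∈ LinearMap.ker L.ω ⊓ LinearMap.ker l := by rw [ht]; trivial
      apply hw
      rw [LinearMap.mem_ker.1 hy.1, LinearMap.zero_apply]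
  have hhx : ∀ x, L.ω x = 0 → l x = 0 → L.bracket h x = x := by
    intro x hx hlx
    rw [L.bracket_radical hl hw hh hx, hlh, hlx]
    simp
  have hcomm : ∀ x, L.ω x = 0 → l x = 0 → ∀ y, L.bracket h (L.bracket x y) =
      L.bracket x y + L.bracket x (L.bracket h y) := by
    intro x hx hlx y
    rw [L.bracket_comm_radical hh hx, hhx x hx hlx]
  have hωh : ∀ y z, L.ω (L.bracket h y) z = L.ω y z - L.ω y (L.bracket h z) := by
    intro y z
    rw [L.ω_bracket_radical hl hh, hlh, one_mul]
  have hωx : ∀ x, L.ω x = 0 → l x = 0 → ∀ y z,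
      L.ω (L.bracket x y) z = - L.ω y (L.bracket x z) := by
    intro x hx hlx y z
    rw [L.ω_bracket_radical hl hx, hlx]
    ring
  -- the operator `ad x` squares to zero modulo the radical
  have hG0 : L.ω (L.bracket x y₁) (L.bracket x y₂) = 0 := by
    obtain ⟨a, b, k, hk, hωk⟩ := L.exists_eq_add_radical hl hw (L.bracket h y₁)
    obtain ⟨c, d, m, hm, hωm⟩ := L.exists_eq_add_radical hl hw (L.bracket h y₂)
    have h1 := hωh y₁ y₂
    have h2 := hωh (L.bracket x y₁) (L.bracket x y₂)
    rw [hcomm x hx hlx, hcomm x hx hlx] at h2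
    rw [hk, hm] at h1 h2
    have e1 := hrad x k hx hlx hωk
    have e2 := L.ω_right_radical (hrad x m hx hlx hωm) (L.bracket x y₁)
    have e3 := L.ω_right_radical hωm y₁
    simp only [map_add, map_smul, LinearMap.add_apply, LinearMap.smul_apply, smul_eq_mul, hωk,
      e1, e2, e3, add_zero, L.ω_self, mul_zero] at h1 h2
    have had : a + d = 1 := by
      refine mul_right_cancel₀ hw ?_
      linear_combination h1
    linear_combination (h2 - L.ω (L.bracket x y₁) (L.bracket x y₂) * had) / 2
  have hG : ∀ t, L.ω (L.bracket x v) (L.bracket x t) = 0 := by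
    intro t
    obtain ⟨a, b, k, hk, hωk⟩ := L.exists_eq_add_radical hl hw v
    obtain ⟨c, d, m, hm, hωm⟩ := L.exists_eq_add_radical hl hw t
    have e1 := hrad x k hx hlx hωk
    have e2 := L.ω_right_radical (hrad x m hx hlx hωm)
    have e3 : L.ω (L.bracket x y₂) (L.bracket x y₁) = 0 := by rw [L.ω_skew, hG0, neg_zero]
    rw [hk, hm]
    simp [e1, e2, hG0, e3, L.ω_self]
  set u := L.bracket x v with hu
  have hxu : L.ω (L.bracket x u) = 0 := by
    ext t
    rw [hωx x hx hlx, hG, LinearMap.zero_apply, neg_zero]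
  have huv : L.ω u v ≠ 0 := by
    intro h0
    obtain ⟨t, ht⟩ : ∃ t, L.ω u t ≠ 0 := by
      by_contra! hcon
      exact hxv (LinearMap.ext hcon)
    obtain ⟨a, b, k, hk, hωk⟩ := L.exists_eq_add_radical hl ht v
    have h1 := h0
    rw [hk] at h1
    simp only [map_add, map_smul, smul_eq_mul, L.ω_self, L.ω_right_radical hωk, mul_zero, zero_add,
      add_zero, mul_eq_zero, ht, or_false] at h1
    rw [h1, zero_smul, add_zero] at hk
    apply hxv
    rw [hu, hk, map_add, map_add, map_smul, map_smul, hxu, hrad x k hx hlx hωk]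
    simp
  -- Modulo the radical, [h,v] = a u + b v and hence [h,u] = (1 + b) u; the trace is 1, so b = 0.
  have hhu : L.ω (L.bracket h u) = L.ω u := by
    obtain ⟨a, b, k, hk, hωk⟩ := L.exists_eq_add_radical hl huv (L.bracket h v)
    have e1 : L.ω (L.bracket h u) = (1 + b) • L.ω u := by
      rw [hu, hcomm x hx hlx, ← hu, hk, map_add, map_add, map_add, map_add, map_add, map_smul,
        map_smul, map_smul, map_smul, hxu, hrad x k hx hlx hωk, ← hu]
      module
    have e2 := hωh u v
    rw [e1, hk] at e2
    simp only [map_add, map_smul, LinearMap.smul_apply, smul_eq_mul, L.ω_self,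
      L.ω_right_radical hωk] at e2
    have hb : b = 0 := by
      refine mul_right_cancel₀ huv ?_
      linear_combination e2 / 2
    rw [e1, hb, add_zero, one_smul]
  have hβh : ∀ y, L.ω u (L.bracket h y) = 0 := by
    intro y
    have e := hωh u y
    rw [hhu] at e
    linear_combination e
  obtain ⟨a, b, k, hk, hωk⟩ := L.exists_eq_add_radical hl huv (L.bracket h v)
  have hb : b = 0 := by
    have e := hβh v
    rw [hk] at e
    simpa [L.ω_self, L.ω_right_radical hωk, huv] using e
  rw [hb, zero_smul, add_zero] at hk
  -- Modulo the radical, ad h multiplies [x,u] by 2, but its eigenvalues there are 1 and 0.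
  have hxu' : ∀ x, L.ω x = 0 → l x = 0 → L.ω (L.bracket x u) = 0 := by
    intro x hx hlx
    have e0 : L.ω (L.bracket h u - u) = 0 := by rw [map_sub, hhu, sub_self]
    have e1 : L.ω (L.bracket h (L.bracket x u)) = (2 : ℂ) • L.ω (L.bracket x u) := by
      have e2 := hrad x _ hx hlx e0
      rw [map_sub, map_sub, sub_eq_zero] at e2
      rw [hcomm x hx hlx, map_add, e2]
      module
    have e3 : L.ω (L.bracket x u) u = 0 := by
      have e4 := hβh (L.bracket x u)
      rw [L.ω_skew, e1, LinearMap.smul_apply, smul_eq_mul] at e4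
      linear_combination -e4 / 2
    refine L.ω_eq_zero_of_apply_eq_zero hl huv e3 ?_
    have e5 := hωh (L.bracket x u) v
    rw [e1, hk, map_add, map_smul, e3, L.ω_right_radical hωk, LinearMap.smul_apply] at e5
    simp only [smul_eq_mul] at e5
    linear_combination e5
  have hβk : ∀ k, L.ω k = 0 → ∀ y, L.ω u (L.bracket k y) = 0 := by
    intro k hk y
    have e1 : L.ω (k - l k • h) = 0 := by rw [map_sub, map_smul, hk, hh]; simp
    have e2 : l (k - l k • h) = 0 := by rw [map_sub, map_smul, hlh]; simp
    have e3 := hωx _ e1 e2 u y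
    rw [hxu' _ e1 e2, LinearMap.zero_apply, map_sub, map_smul, LinearMap.sub_apply,
      LinearMap.smul_apply, map_sub, map_smul, hβh] at e3
    simpa using e3.symm
  have hβuv : L.ω u (L.bracket u v) = 0 := by
    have e0 : L.ω (L.bracket h u - u) = 0 := by rw [map_sub, hhu, sub_self]
    have e1 := congrArg (L.ω u) (L.bracket_bracket h u v)
    have e2 := hβk _ e0 v
    have e3 := hβk k hωk u
    rw [L.bracket_skew, map_neg, neg_eq_zero] at e3
    rw [hk] at e1
    simp only [map_add, map_sub, map_smul, LinearMap.sub_apply, hβh, hh, LinearMap.zero_apply,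
      L.bracket_self, e3, L.ω_right_radical hh, smul_zero, zero_smul, map_zero, add_zero,
      sub_zero] at e1 e2
    rw [e1] at e2
    simpa using e2
  -- The nonzero functional ω(u,·) kills every bracket, which simplicity forbids.
  refine hxv (hL.eq_zero_of_apply_bracket _ fun p q => ?_)
  obtain ⟨a, b, k, rfl, hωk⟩ := L.exists_eq_add_radical hl huv p
  obtain ⟨c, d, m, rfl, hωm⟩ := L.exists_eq_add_radical hl huv q
  have e1 : ∀ y, L.ω u (L.bracket y m) = 0 := fun y => by
    rw [L.bracket_skew, map_neg, hβk m hωm, neg_zero]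
  have e2 : L.ω u (L.bracket v u) = 0 := by rw [L.bracket_skew, map_neg, hβuv, neg_zero]
  simp only [map_add, map_smul, LinearMap.add_apply, LinearMap.smul_apply, L.bracket_self, e1, e2,
    hβuv, hβk k hωk, smul_zero, map_zero, add_zero]

/-- In dimension at least four, the cochain bounding `ω` cannot vanish on the radical of `ω`
unless `ω = 0`. -/
lemma IsSimple.exists_apply_radical_ne_zero [FiniteDimensional ℂ V] {L : OmegaLieAlgebra V}
    (hL : L.IsSimple) (hn : 4 ≤ finrank ℂ V) {l : V →ₗ[ℂ] ℂ}
    (hl : ∀ x y, L.ω x y = l (L.bracket x y)) (h0 : L.ω ≠ 0) :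
    ∃ h, L.ω h = 0 ∧ l h ≠ 0 := by
  by_contra! hcon
  obtain ⟨y₂, hy₂⟩ : ∃ y, l y = 1 := by
    obtain ⟨y, hy⟩ : ∃ y, l y ≠ 0 := by
      by_contra! hc
      exact h0 (LinearMap.ext fun x => LinearMap.ext fun y => by rw [hl, hc]; rfl)
    exact ⟨(l y)⁻¹ • y, by simp [hy]⟩
  -- As l vanishes on the radical, it is determined by its values on y and y₂.
  have hgen : ∀ y, l y = 0 → L.ω y y₂ = 1 → L.ω y = l := by
    intro y hy hy'
    ext v
    have hw : L.ω y y₂ ≠ 0 := by simp [hy']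
    obtain ⟨a, b, k, rfl, hωk⟩ := L.exists_eq_add_radical hl hw v
    simp [hy, hy₂, hy', L.ω_self, L.ω_right_radical hωk, hcon k hωk]
  obtain ⟨t, hlt, ht⟩ : ∃ t, l t = 0 ∧ L.ω t y₂ = 1 := by
    obtain ⟨t, ht⟩ : ∃ t, L.ω y₂ t ≠ 0 := by
      by_contra! hc
      have := hcon y₂ (LinearMap.ext hc)
      rw [hy₂] at this
      exact one_ne_zero this
    have ht' : L.ω t y₂ ≠ 0 := by rwa [L.ω_skew, neg_ne_zero]
    refine ⟨(L.ω t y₂)⁻¹ • (t - l t • y₂), ?_, ?_⟩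
    · simp [hy₂]
    · simp [L.ω_self, ht']
  have hmem : ∀ {y v : V}, l y = 0 → L.ω y y₂ = 1 → l v = 0 → L.ω v y₂ = 0 → L.ω v = 0 := by
    intro y v hy hy' hv hv'
    refine L.ω_eq_zero_of_apply_eq_zero hl (y₁ := y) (y₂ := y₂) (by simp [hy']) ?_ hv'
    rw [L.ω_skew, hgen y hy hy', hv, neg_zero]
  have hlb : ∀ x, L.ω x = 0 → ∀ y, l (L.bracket x y) = 0 := fun x hx y => by
    rw [← hl, hx, LinearMap.zero_apply]
  have hab : ∀ x y, L.ω x = 0 → L.ω y = 0 → L.bracket x y = 0 := by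
    intro x y hx hy
    rw [L.bracket_radical hl (y₁ := t) (y₂ := y₂) (by simp [ht]) hx hy, hcon x hx, hcon y hy]
    simp
  have hωx : ∀ x, L.ω x = 0 → ∀ y z, L.ω (L.bracket x y) z = - L.ω y (L.bracket x z) := by
    intro x hx y z
    rw [L.ω_bracket_radical hl hx, hcon x hx]
    ring
  -- If ψ(x) = ω([x,y₂],y₂) vanished on the radical, the radical would be an ideal.
  obtain ⟨x, hx, hψx⟩ : ∃ x, L.ω x = 0 ∧ L.ω (L.bracket x y₂) y₂ = 1 := by
    obtain ⟨x, hx, hψx⟩ : ∃ x, L.ω x = 0 ∧ L.ω (L.bracket x y₂) y₂ ≠ 0 := by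
      by_contra! hc
      have hI : L.IsIdeal (LinearMap.ker L.ω) := by
        intro x hx v
        rw [LinearMap.mem_ker] at hx ⊢
        refine hmem hlt ht (hlb x hx v) ?_
        rw [hωx x hx, L.ω_right_radical (hmem hlt ht (hlb x hx _) (hc x hx)), neg_zero]
      rcases hL.2 _ hI with hb | htop
      · obtain ⟨x, hx0, h1, h2, h3⟩ :=
          exists_ne_zero_of_four_le_finrank hn (L.ω.flip y₂) l 0
        have hx : x ∈ LinearMap.ker L.ω := hmem hlt ht h2 h1
        rw [hb] at hx
        exact hx0 (by simpa using hx)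
      · exact h0 (LinearMap.ker_eq_top.1 htop)
    refine ⟨(L.ω (L.bracket x y₂) y₂)⁻¹ • x, by simp [hx], ?_⟩
    simp [hψx]
  set y₁ := L.bracket x y₂ with hy₁
  have hly₁ : l y₁ = 0 := hlb x hx y₂
  have hβ := hgen y₁ hly₁ hψx
  have hmem' : ∀ {v : V}, l v = 0 → L.ω v y₂ = 0 → L.ω v = 0 := hmem hly₁ hψx
  have hky₁ : ∀ k, L.ω k = 0 → L.ω (L.bracket k y₂) y₂ = 0 → L.bracket k y₁ = 0 := by
    intro k hk hψk
    rw [hy₁, L.bracket_comm_radical hk hx, hab k x hk hx,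
      hab x _ hx (hmem' (hlb k hk _) hψk)]
    simp
  -- A nonzero k in the radical with ψ(k) = 0. It will turn out to span an ideal.
  obtain ⟨k, hk0, h1, h2, h3⟩ :=
    exists_ne_zero_of_four_le_finrank hn (L.ω.flip y₂) l (L.ω.flip y₂ ∘ₗ L.bracket.flip y₂)
  have hk : L.ω k = 0 := hmem' h2 h1
  have hψk : L.ω (L.bracket k y₂) y₂ = 0 := h3
  have hkk := hky₁ k hk hψk
  set q := L.bracket k y₂ with hq
  have hωq : L.ω q = 0 := hmem' (hlb k hk _) hψk
  set p := L.bracket x y₁ with hp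
  have hωp : L.ω p = 0 := by
    refine hmem' (hlb x hx _) ?_
    rw [hp, hωx x hx, ← hy₁, L.ω_self, neg_zero]
  have hw : L.ω y₁ y₂ ≠ 0 := by simp [hψx]
  obtain ⟨a, b, m, hz, hωm⟩ := L.exists_eq_add_radical hl hw (L.bracket y₁ y₂)
  have hb : b = 1 := by
    have e := hl y₁ y₂
    rw [hz, hψx] at e
    simpa [hly₁, hy₂, hcon m hωm, eq_comm] using e
  rw [hb, one_smul] at hz
  have hqy₁ : L.bracket q y₁ = -q - k := by
    have e := L.bracket_bracket y₁ y₂ k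
    rw [L.bracket_skew _ k, hz, L.bracket_skew y₂ k, L.bracket_skew y₁ k, hkk, hψx,
      L.ω_right_radical hk, L.ω_right_radical hk] at e
    simp only [map_add, map_smul, hkk, hab k m hk hωm, ← hq, map_neg, neg_zero, map_zero] at e
    rw [L.bracket_skew]
    linear_combination (norm := module) -e
  have hpy₂ : L.bracket p y₂ = a • p + y₁ + x := by
    have e := L.bracket_bracket y₁ y₂ x
    rw [L.bracket_skew _ x, hz, L.bracket_skew y₂ x, L.bracket_skew y₁ x, hψx,
      L.ω_right_radical hx, L.ω_right_radical hx] at e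
    simp only [map_add, map_smul, ← hp, hab x m hx hωm, ← hy₁, map_neg, L.bracket_self] at e
    rw [L.bracket_skew]
    linear_combination (norm := module) e
  set s := L.ω (L.bracket q y₂) y₂ with hs
  -- The vector q - s x lies in the radical and in ker ψ, so its bracket with y₁ is zero.
  have hq0 : L.bracket q y₁ = s • p := by
    have e := hky₁ (q - s • x) (by simp [hωq, hx]) (by simp [← hy₁, hψx, hs])
    rw [map_sub, map_smul, LinearMap.sub_apply, LinearMap.smul_apply, ← hp] at e
    exact sub_eq_zero.1 e
  -- Apply ψ to s p = -q - k: since ψ(p) = 1 and ψ(k) = 0, this gives s = -s.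
  have hs0 : s = 0 := by
    have e1 := congrArg (fun r => L.ω (L.bracket r y₂) y₂) (hq0.symm.trans hqy₁)
    simp only [map_sub, map_neg, map_smul, LinearMap.sub_apply, LinearMap.neg_apply,
      LinearMap.smul_apply, hpy₂, ← hs, map_add, LinearMap.add_apply, hωp, hx, hψx, smul_zero,
      LinearMap.zero_apply, smul_eq_mul, ← hq, hψk] at e1
    linear_combination e1 / 2
  have hqk : q = -k := by
    rw [hs0, zero_smul, hqy₁] at hq0
    linear_combination (norm := module) -hq0
  refine hk0 (hL.eq_zero_of_forall_bracket_eq_smul fun y => ?_)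
  obtain ⟨a, b, m, rfl, hωm⟩ := L.exists_eq_add_radical hl hw y
  refine ⟨-b, ?_⟩
  rw [map_add, map_add, map_smul, map_smul, hkk, ← hq, hqk, hab k m hk hωm]
  module

/-- A simple `ω`-Lie algebra of dimension at least four is a Lie algebra. -/
lemma IsSimple.ω_eq_zero [FiniteDimensional ℂ V] {L : OmegaLieAlgebra V}
    (hL : L.IsSimple) (hn : 4 ≤ finrank ℂ V) : L.ω = 0 := by
  by_contra h0
  obtain ⟨l, hl⟩ := L.exists_ω_eq_apply_bracket (by omega)
  obtain ⟨y₁, y₂, hw⟩ : ∃ x y, L.ω x y ≠ 0 := by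
    by_contra! hc
    exact h0 (LinearMap.ext fun x => LinearMap.ext fun y => hc x y)
  obtain ⟨h, hh, hlh⟩ := hL.exists_apply_radical_ne_zero hn hl h0
  exact hL.apply_radical_ne_one hn hl hw (h := (l h)⁻¹ • h) (by simp [hh]) (by simp [hlh])

/-! ### Dimension three: nilpotent half-derivations -/

/-- The vectors are independent, being eigenvectors of ad e₀ for the distinct values 0, 1, α; the
Jacobi identity on them then forces ω. -/
lemma isTypeC_of_bracket {L : OmegaLieAlgebra V} (hn : finrank ℂ V = 3) {α : ℂ} (hα0 : α ≠ 0)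
    (hα1 : α ≠ 1) {e₀ e₁ e₂ : V} (h0 : e₀ ≠ 0) (h01 : L.bracket e₀ e₁ = e₁)
    (h02 : L.bracket e₀ e₂ = α • e₂) (h12 : L.bracket e₁ e₂ = e₀) : L.IsTypeC α := by
  have h1 : e₁ ≠ 0 := by rintro rfl; simp at h12; exact h0 h12.symm
  have h2 : e₂ ≠ 0 := by rintro rfl; simp at h12; exact h0 h12.symm
  have hli : LinearIndependent ℂ ![e₀, e₁, e₂] := by
    refine End.eigenvectors_linearIndependent' (L.bracket e₀) ![0, 1, α] ?_ _ ?_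
    · intro i j hij
      fin_cases i <;> fin_cases j <;> simp_all
    · intro i
      rw [End.hasEigenvector_iff, End.mem_eigenspace_iff]
      fin_cases i <;> simp [h0, h1, h2, h01, h02, L.bracket_self]
  have : Fintype.card (Fin 3) = finrank ℂ V := by simp [hn]
  set e := basisOfLinearIndependentOfCardEqFinrank hli this with he
  have he0 : e 0 = e₀ := by simp [he]
  have he1 : e 1 = e₁ := by simp [he]
  have he2 : e 2 = e₂ := by simp [he]
  have hj := L.bracket_bracket e₀ e₁ e₂
  rw [h01, h12, L.bracket_self, h02, map_smul, h12] at hj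
  have hj' : L.ω e₁ e₂ • e 0 + (- L.ω e₀ e₂) • e 1 + L.ω e₀ e₁ • e 2 = (1 + α) • e 0 := by
    rw [he0, he1, he2]
    linear_combination (norm := module) -hj
  have hc : ∀ i, e.coord i (L.ω e₁ e₂ • e 0 + (- L.ω e₀ e₂) • e 1 + L.ω e₀ e₁ • e 2)
      = e.coord i ((1 + α) • e 0) := fun i => by rw [hj']
  have c0 := hc 0
  have c1 := hc 1
  have c2 := hc 2
  simp at c0 c1 c2
  exact ⟨e, by rw [he0, he1, h01], by rw [he0, he2, h02], by rw [he1, he2, h12, he0],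
    by rw [he0, he1, c2], by rw [he0, he2, c1], by rw [he1, he2, c0]⟩

lemma IsSimple.eq_zero_of_apply_basis {L : OmegaLieAlgebra V} (hL : L.IsSimple)
    (e : Basis (Fin 3) ℂ V) (φ : V →ₗ[ℂ] ℂ) (h01 : φ (L.bracket (e 0) (e 1)) = 0)
    (h02 : φ (L.bracket (e 0) (e 2)) = 0) (h12 : φ (L.bracket (e 1) (e 2)) = 0) : φ = 0 := by
  refine hL.eq_zero_of_apply_bracket φ fun x y => ?_
  have h : (L.bracket.compr₂ φ) = 0 := by
    refine e.ext fun i => e.ext fun j => ?_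
    have h10 : φ (L.bracket (e 1) (e 0)) = 0 := by rw [L.bracket_skew, map_neg, h01, neg_zero]
    have h20 : φ (L.bracket (e 2) (e 0)) = 0 := by rw [L.bracket_skew, map_neg, h02, neg_zero]
    have h21 : φ (L.bracket (e 2) (e 1)) = 0 := by rw [L.bracket_skew, map_neg, h12, neg_zero]
    fin_cases i <;> fin_cases j <;> simp [h01, h02, h12, h10, h20, h21, L.bracket_self]
  exact LinearMap.congr_fun₂ h x y

/-- Here N is one Jordan block, and applying N to [e 0, e 1] twice yields the other two brackets. -/
lemma isTypeC_neg_four {L : OmegaLieAlgebra V} (hL : L.IsSimple) {N : V →ₗ[ℂ] V}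
    (hN : L.IsHalfDerivation N) (e : Basis (Fin 3) ℂ V) (h0 : N (e 0) = e 1)
    (h1 : N (e 1) = e 2) (h2 : N (e 2) = 0) : L.IsTypeC (-4) := by
  have hn : finrank ℂ V = 3 := by simp [finrank_eq_card_basis e]
  obtain ⟨a, b, c, hvu⟩ : ∃ a b c : ℂ, L.bracket (e 0) (e 1) = a • e 0 + b • e 1 + c • e 2 :=
    ⟨_, _, _, by rw [← Fin.sum_univ_three (fun i => e.repr (L.bracket (e 0) (e 1)) i • e i),
      e.sum_repr]⟩
  have hvt : L.bracket (e 0) (e 2) = (2 * a) • e 1 + (2 * b) • e 2 := by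
    have h := hN (e 0) (e 1)
    rw [hvu, h0, h1, L.bracket_self] at h
    simp only [map_add, map_smul, h0, h1, h2] at h
    linear_combination (norm := module) (-2 : ℂ) • h
  have hut : L.bracket (e 1) (e 2) = (4 * a) • e 2 := by
    have h := hN (e 0) (e 2)
    rw [hvt, h0, h2] at h
    simp only [map_add, map_smul, h1, h2, map_zero] at h
    linear_combination (norm := module) (-2 : ℂ) • h
  have ha : a ≠ 0 := by
    rintro rfl
    have h := hL.eq_zero_of_apply_basis e (e.coord 0) (by simp [hvu]) (by simp [hvt])
      (by simp [hut])
    simpa using LinearMap.congr_fun h (e 0)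
  have hvu' : L.bracket (e 1) (e 0) = -(a • e 0 + b • e 1 + c • e 2) := by
    rw [L.bracket_skew, hvu]
  have hvt' : L.bracket (e 2) (e 0) = -((2 * a) • e 1 + (2 * b) • e 2) := by
    rw [L.bracket_skew, hvt]
  have hut' : L.bracket (e 2) (e 1) = -((4 * a) • e 2) := by rw [L.bracket_skew, hut]
  -- ad (e 1) is triangular with diagonal -a, 0, 4a; dividing by -a gives 1, 0, -4. The remaining
  -- coefficients make the eigenvectors exact.
  refine isTypeC_of_bracket hn (by norm_num) (by norm_num)
    (e₀ := (-a⁻¹) • e 1 + (b / a ^ 2) • e 2)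
    (e₁ := e 0 + (-(b / a)) • e 1 + ((c / a + 2 * b ^ 2 / a ^ 2) / 5) • e 2)
    (e₂ := (-(1 / (2 * a ^ 2))) • e 2) ?_ ?_ ?_ ?_
  · intro h
    simpa [ha] using congrArg (e.coord 1) h
  all_goals
    simp only [map_add, map_smul, LinearMap.add_apply, LinearMap.smul_apply, L.bracket_self,
      hvt, hut, hvu', hvt', hut']
    match_scalars <;> field_simp <;> ring

/-- Here N has rank one and square zero. The ½-derivation rule puts [e 0, e 1] in ker N and makes [e
1, e 2] a multiple of e 1. -/
lemma isTypeC_two {L : OmegaLieAlgebra V} (hL : L.IsSimple) {N : V →ₗ[ℂ] V}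
    (hN : L.IsHalfDerivation N) (e : Basis (Fin 3) ℂ V) (h0 : N (e 0) = e 1)
    (h1 : N (e 1) = 0) (h2 : N (e 2) = 0) : L.IsTypeC 2 := by
  have hn : finrank ℂ V = 3 := by simp [finrank_eq_card_basis e]
  have hexp : ∀ x, ∃ a b c : ℂ, x = a • e 0 + b • e 1 + c • e 2 := fun x =>
    ⟨_, _, _, by rw [← Fin.sum_univ_three (fun i => e.repr x i • e i), e.sum_repr]⟩
  have hker : ∀ x, N x = 0 → e.coord 0 x = 0 := by
    intro x hx
    obtain ⟨a, b, c, rfl⟩ := hexp x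
    have := congrArg (e.coord 1) hx
    simp [h0, h1, h2] at this
    simp [this]
  obtain ⟨a', a, b, hvu⟩ := hexp (L.bracket (e 0) (e 1))
  obtain ⟨s, m, l, hvw⟩ := hexp (L.bracket (e 0) (e 2))
  have ha' : a' = 0 := by
    have h := hN (e 0) (e 1)
    rw [h0, h1, L.bracket_self] at h
    simpa [hvu] using hker _ (h.trans (by simp))
  rw [ha', zero_smul, zero_add] at hvu
  have huw : L.bracket (e 1) (e 2) = (2 * s) • e 1 := by
    have h := hN (e 0) (e 2)
    rw [hvw, h0, h2] at h
    simp only [map_add, map_smul, h0, h1, h2, map_zero] at h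
    linear_combination (norm := module) (-2 : ℂ) • h
  have hs : s ≠ 0 := by
    rintro rfl
    have h := hL.eq_zero_of_apply_basis e (e.coord 0) (by simp [hvu]) (by simp [hvw])
      (by simp [huw])
    simpa using LinearMap.congr_fun h (e 0)
  have hb : b ≠ 0 := by
    rintro rfl
    have h := hL.eq_zero_of_apply_basis e (l • e.coord 0 - s • e.coord 2) (by simp [hvu])
      (by simp [hvw, mul_comm]) (by simp [huw])
    exact hs (by simpa using LinearMap.congr_fun h (e 2))
  have hvu' : L.bracket (e 1) (e 0) = -(a • e 1 + b • e 2) := by rw [L.bracket_skew, hvu]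
  have hvw' : L.bracket (e 2) (e 0) = -(s • e 0 + m • e 1 + l • e 2) := by
    rw [L.bracket_skew, hvw]
  have huw' : L.bracket (e 2) (e 1) = -((2 * s) • e 1) := by rw [L.bracket_skew, huw]
  -- ad (e 2) is triangular with diagonal -s, -2s, 0; dividing by -s gives 1, 2, 0. The relation
  -- [e₁,e₂] = e₀ fixes x, and [e₀,e₁] = e₁ then fixes r and the `e 1` coefficient of e₁.
  obtain ⟨r, hr⟩ : ∃ r, r = (a + l) / (3 * s) := ⟨_, rfl⟩
  obtain ⟨x, hx⟩ : ∃ x, x = -(1 / (s * b)) * (a - 2 * s * r) := ⟨_, rfl⟩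
  refine isTypeC_of_bracket hn (by norm_num) (by norm_num)
    (e₀ := x • e 1 + (-s⁻¹) • e 2)
    (e₁ := e 0 + (x * (a - 2 * s * r) - m / s) • e 1 + r • e 2)
    (e₂ := (-(1 / (s * b))) • e 1) ?_ ?_ ?_ ?_
  · intro h
    simpa [hs] using congrArg (e.coord 2) h
  all_goals
    simp only [map_add, map_smul, LinearMap.add_apply, LinearMap.smul_apply, L.bracket_self, hvu,
      huw, hvu', hvw', huw']
    rw [hx, hr]
    match_scalars <;> field_simp <;> ring

/-- If [x,y] ≠ 0, then x and y are independent; in dimension two every bracket is then a multiple of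
[x,y], which spans an ideal. -/
lemma IsSimple.three_le_finrank [FiniteDimensional ℂ V] {L : OmegaLieAlgebra V}
    (hL : L.IsSimple) : 3 ≤ finrank ℂ V := by
  by_contra! hlt
  obtain ⟨x, y, hxy⟩ := hL.1
  have hli : LinearIndependent ℂ ![x, y] := by
    rw [LinearIndependent.pair_iff]
    intro s t hst
    have h1 := congrArg (L.bracket x) hst
    have h2 := congrArg (fun v => L.bracket v y) hst
    simp [L.bracket_self, hxy] at h1 h2
    exact ⟨h2, h1⟩
  have hcard := hli.fintype_card_le_finrank
  rw [Fintype.card_fin] at hcard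
  have h2 : Fintype.card (Fin 2) = finrank ℂ V := by rw [Fintype.card_fin]; omega
  refine hxy (hL.eq_zero_of_forall_bracket_eq_smul fun z => ?_)
  have key : ∀ p q, ∃ c : ℂ, L.bracket p q = c • L.bracket x y := by
    intro p q
    set e := basisOfLinearIndependentOfCardEqFinrank hli h2 with he
    have he0 : e 0 = x := by simp [he]
    have he1 : e 1 = y := by simp [he]
    have hexp : ∀ p, p = e.repr p 0 • x + e.repr p 1 • y := fun p => by
      rw [← he0, ← he1, ← Fin.sum_univ_two (fun i => e.repr p i • e i), e.sum_repr]
    refine ⟨e.repr p 0 * e.repr q 1 - e.repr p 1 * e.repr q 0, ?_⟩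
    conv_lhs => rw [hexp p, hexp q]
    simp only [map_add, map_smul, LinearMap.add_apply, LinearMap.smul_apply, L.bracket_self,
      L.bracket_skew y x]
    module
  exact key _ z

/-- A nonzero nilpotent half-derivation exists only on `C₂` and `C₋₄`. -/
lemma IsHalfDerivation.isTypeC_of_isNilpotent [FiniteDimensional ℂ V] {L : OmegaLieAlgebra V}
    (hL : L.IsSimple) (hn : finrank ℂ V = 3) {N : End ℂ V} (hN : L.IsHalfDerivation N)
    (hnil : IsNilpotent N) (h0 : N ≠ 0) : L.IsTypeC 2 ∨ L.IsTypeC (-4) := by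
  have hcard : Fintype.card (Fin 3) = finrank ℂ V := by simp [hn]
  have hN3 : ∀ v, N (N (N v)) = 0 := by
    intro v
    obtain ⟨m, hm⟩ := hnil
    have h : v ∈ LinearMap.ker (N ^ finrank ℂ V) :=
      End.ker_pow_le_ker_pow_finrank N m (by rw [hm]; rfl)
    rw [hn] at h
    simpa [pow_succ] using h
  by_cases hN2 : ∃ v, N (N v) ≠ 0
  · obtain ⟨v, hv⟩ := hN2
    have hli : LinearIndependent ℂ ![v, N v, N (N v)] := by
      rw [Fintype.linearIndependent_iff]
      intro g hg
      simp only [Fin.sum_univ_three, Matrix.cons_val] at hg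
      have hg1 := congrArg N hg
      have hg2 := congrArg N hg1
      simp only [map_add, map_smul, hN3, smul_zero, add_zero, map_zero, smul_eq_zero, hv,
        or_false] at hg2
      simp only [map_add, map_smul, hN3, smul_zero, add_zero, map_zero, hg2, zero_smul, zero_add,
        smul_eq_zero, hv, or_false] at hg1
      simp only [hg1, hg2, zero_smul, zero_add, smul_eq_zero, hv, or_false] at hg
      intro i
      fin_cases i <;> assumption
    right
    exact isTypeC_neg_four hL hN (basisOfLinearIndependentOfCardEqFinrank hli hcard)
      (by simp) (by simp) (by simp [hN3])
  · push Not at hN2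
    obtain ⟨v, hv⟩ : ∃ v, N v ≠ 0 := by
      by_contra! hc
      exact h0 (LinearMap.ext hc)
    -- As N² = 0, the range lies in the kernel, so the kernel has dimension at least 2 and is not
    -- the line through N v.
    obtain ⟨w, hw, hwv⟩ : ∃ w, N w = 0 ∧ w ∉ (ℂ ∙ N v) := by
      by_contra! hc
      have h1 : LinearMap.ker N ≤ ℂ ∙ N v := hc
      have h2 : LinearMap.range N ≤ LinearMap.ker N := by
        rintro _ ⟨x, rfl⟩
        exact hN2 x
      have h3 := Submodule.finrank_mono h1
      have h4 := Submodule.finrank_mono h2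
      have h5 := LinearMap.finrank_range_add_finrank_ker N
      rw [finrank_span_singleton hv] at h3
      omega
    have hli : LinearIndependent ℂ ![v, N v, w] := by
      rw [Fintype.linearIndependent_iff]
      intro g hg
      simp only [Fin.sum_univ_three, Matrix.cons_val] at hg
      have hg1 := congrArg N hg
      simp only [map_add, map_smul, hN2, hw, smul_zero, add_zero, map_zero, smul_eq_zero, hv,
        or_false] at hg1
      rw [hg1, zero_smul, zero_add] at hg
      have hg2 : g 2 = 0 := by
        by_contra hg2
        refine hwv (Submodule.mem_span_singleton.2 ⟨-(g 2)⁻¹ * g 1, ?_⟩)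
        have h := congrArg ((g 2)⁻¹ • ·) hg
        simp only [smul_add, smul_smul, inv_mul_cancel₀ hg2, smul_zero] at h
        linear_combination (norm := module) -h
      simp only [hg2, zero_smul, add_zero, smul_eq_zero, hv, or_false] at hg
      intro i
      fin_cases i <;> assumption
    left
    exact isTypeC_two hL hN (basisOfLinearIndependentOfCardEqFinrank hli hcard)
      (by simp) (by simp [hN2]) (by simp [hw])

/-! ### Separating vectors and the theorem -/

/-- Half-derivations of `C_α` are determined by their value at `e₂` for generic `α`. -/
lemma IsTypeC.exists_separating {L : OmegaLieAlgebra V} {α : ℂ} (hα : L.IsTypeC α)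
    (h2 : 2 * α ≠ 1) (h4 : 4 * α ≠ -1) :
    ∃ v, ∀ D, L.IsHalfDerivation D → D v = 0 → D = 0 := by
  obtain ⟨e, h01, h02, h12, -⟩ := hα
  have hexp : ∀ x, ∃ a b c : ℂ, x = a • e 0 + b • e 1 + c • e 2 := fun x =>
    ⟨_, _, _, by rw [← Fin.sum_univ_three (fun i => e.repr x i • e i), e.sum_repr]⟩
  have h10 : L.bracket (e 1) (e 0) = -e 1 := by rw [L.bracket_skew, h01]
  have h21 : L.bracket (e 2) (e 1) = -e 0 := by rw [L.bracket_skew, h12]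
  refine ⟨e 1, fun D hD hD1 => ?_⟩
  obtain ⟨t, s, t', h0⟩ := hexp (D (e 0))
  obtain ⟨p, q, r, hD2⟩ := hexp (D (e 2))
  have k01 := hD (e 0) (e 1)
  have k02 := hD (e 0) (e 2)
  have k12 := hD (e 1) (e 2)
  simp only [h01, h02, h12, h0, hD1, hD2, map_zero, map_add, map_smul, LinearMap.add_apply,
    LinearMap.smul_apply, L.bracket_self, h21, LinearMap.zero_apply, h10] at k01 k02 k12
  have c01 := fun i => congrArg (e.coord i) k01
  have c02 := fun i => congrArg (e.coord i) k02
  have c12 := fun i => congrArg (e.coord i) k12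
  have a1 := c01 0
  have a2 := c01 1
  have b0 := c02 0
  have b1 := c02 1
  have d0 := c12 0
  have d1 := c12 1
  simp at a1 a2 b0 b1 d0 d1
  -- The excluded values -1/4 and 1/2 of α are those at which the equations for p and q,
  -- respectively, degenerate.
  have hp : p = 0 := by
    have h : (4 * α + 1) * p = 0 := by linear_combination 4 * b0 + 2 * d1
    exact (mul_eq_zero.1 h).resolve_left fun h => h4 (eq_neg_of_add_eq_zero_left h)
  have hq : q = 0 := b1.resolve_left fun h => h2 (by rw [h]; norm_num)
  have hr : r = 0 := by linear_combination 2 * a2 - 2 * d0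
  rw [hp, mul_zero, neg_zero] at d1
  refine e.ext fun i => ?_
  fin_cases i
  · simp [h0, a1, a2, d1]
  · simp [hD1]
  · simp [hD2, hp, hq, hr]

end OmegaLieAlgebra

open OmegaLieAlgebra in
theorem mainTheorem8 {V : Type*} [AddCommGroup V] [Module ℂ V] [FiniteDimensional ℂ V]
    (L : OmegaLieAlgebra V) (hL : L.IsSimple)
    (f : V → V) (hf : L.IsTwoLocalHalfDerivation f) :
    (∃ D : V →ₗ[ℂ] V, L.IsHalfDerivation D ∧ ∀ x, f x = D x) ∧
    (¬ L.IsTypeC 2 → ¬ L.IsTypeC (-4) → ∃ c : ℂ, ∀ x, f x = c • x) := by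
  have hsc : ¬ L.IsTypeC 2 → ¬ L.IsTypeC (-4) → ∀ D, L.IsHalfDerivation D →
      ∃ c : ℂ, ∀ x, D x = c • x := by
    intro h2 h4 D hD
    rcases hL.three_le_finrank.eq_or_lt with hn | hn
    · obtain ⟨c, hc⟩ := hD.exists_isNilpotent hL
      refine ⟨c, fun x => ?_⟩
      by_contra hx
      have h0 : D - c • (1 : Module.End ℂ V) ≠ 0 := fun h =>
        hx (sub_eq_zero.1 (LinearMap.congr_fun h x))
      exact ((hD.sub_smul_one c).isTypeC_of_isNilpotent hL hn.symm hc h0).elim h2 h4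
    · refine hD.exists_eq_smul_of_ω_eq_zero hL fun x y => ?_
      rw [hL.ω_eq_zero hn]
      rfl
  have hsep : ∃ v, ∀ D, L.IsHalfDerivation D → D v = 0 → D = 0 := by
    by_cases h2 : L.IsTypeC 2
    · exact h2.exists_separating (by norm_num) (by norm_num)
    by_cases h4 : L.IsTypeC (-4)
    · exact h4.exists_separating (by norm_num) (by norm_num)
    obtain ⟨x, y, hxy⟩ := hL.1
    refine ⟨L.bracket x y, fun D hD h0 => ?_⟩
    obtain ⟨c, hc⟩ := hsc h2 h4 D hD
    rw [hc, smul_eq_zero] at h0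
    ext z
    simp [hc, h0.resolve_right hxy]
  obtain ⟨v, hv⟩ := hsep
  obtain ⟨D, hD, hfv, -⟩ := hf v v
  have hfD : ∀ x, f x = D x := by
    intro x
    obtain ⟨E, hE, hEv, hEx⟩ := hf v x
    have h := hv (E - D) (hE.sub hD) (by rw [LinearMap.sub_apply, ← hEv, ← hfv, sub_self])
    rw [hEx, sub_eq_zero.1 h]
  refine ⟨⟨D, hD, hfD⟩, fun h2 h4 => ?_⟩
  obtain ⟨c, hc⟩ := hsc h2 h4 D hD
  exact ⟨c, fun x => by rw [hfD, hc]⟩
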